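/- For $\mathbf x=(x_1,\dots,x_n)\in\mathbb R^n$ let $\|\mathbf x\|_\infty=\max_i|x_i|$. For $M\subset\mathbb R^d$, a set $M'\subset\mathbb R^n$ is called an $\ell_\infty$-isometric copy of $M$ if there is a bijection $f:M\to M'$ with $\|f(\mathbf x)-f(\mathbf y)\|_\infty=\|\mathbf x-\mathbf y\|_\infty$ for all $\mathbf x,\mathbf y\in M$. Theorem 5. For every $d$ and every finite set $M\subset\mathbb R^d$ there exists $n$ such that for every coloring of $\mathbb R^n$, with any (finite or infinite) set of colors, there is an $\ell_\infty$-isometric copy $M'\subset\mathbb R^n$ of $M$ that is either monochromatic (all points of $M'$ have the same color) or rainbow (the points of $M'$ have pairwise different colors). -/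

import Mathlib

/-- `A' ⊆ ℝⁿ` is an `ℓ∞`-isometric copy of `A ⊆ ℝᵈ`: there is a bijection `f : A → A'` with
`‖f x - f y‖ = ‖x - y‖` for all `x, y ∈ A`. The norm that Mathlib puts on `Fin n → ℝ` is
the max-norm `‖x‖ = max_i |x i|`. -/
def IsMaxNormCopy {d n : ℕ} (A : Set (Fin d → ℝ)) (A' : Set (Fin n → ℝ)) : Prop :=
  ∃ f : (Fin d → ℝ) → (Fin n → ℝ), Set.BijOn f A A' ∧
    ∀ x ∈ A, ∀ y ∈ A, ‖f x - f y‖ = ‖x - y‖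

/-- All points of `S` have the same color. -/
def IsMonochromatic {X κ : Type*} (c : X → κ) (S : Set X) : Prop :=
  ∀ x ∈ S, ∀ y ∈ S, c x = c y

/-- All points of `S` have pairwise different colors. -/
def IsRainbow {X κ : Type*} (c : X → κ) (S : Set X) : Prop :=
  ∀ x ∈ S, ∀ y ∈ S, x ≠ y → c x ≠ c y

open Function Combinatorics

/-! Put `M` in a cube over a finite alphabet `A ⊂ ℝ` whose letters are joined by steps of length at
most `δ`, a positive lower bound for the distances in `M`. Coordinates that vary only between
letters `a`, `b` at distance at most `δ` can be added to a copy freely, so each point has many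
candidate positions. If every point sees at least `|M|` colours, Hall's theorem gives a rainbow
copy. Otherwise pigeonhole finds a block whose switch from `a` to `b` never changes the colour;
Hales–Jewett forces one alternative uniformly (`exists_subcube_insensitive_coordinate`). Iterating
over coordinates and short steps leaves a rainbow copy or a monochromatic subcube. -/

/-- Maps between cubes in which every coordinate of the image is constant or a copy of a coordinate
of the argument, and every coordinate of the argument is copied (this is slightly more general than
the map of a combinatorial subspace). -/
def IsSubcubeMap {α η ι : Type*} (g : (η → α) → (ι → α)) : Prop :=
  (∀ i x y, g x i = g y i ∨ ∃ j, g x i = x j ∧ g y i = y j) ∧ ∀ j, ∃ i, ∀ x, g x i = x j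

/-- The colouring `c` of the cube `ι → α` has a rainbow isometric copy of `X`. -/
def HasRainbowCopy (X : Type*) {α ι κ : Type*} [Fintype ι] [PseudoMetricSpace X]
    [PseudoMetricSpace α] (c : (ι → α) → κ) : Prop :=
  ∃ f : X → (ι → α), Isometry f ∧ Injective (c ∘ f)

theorem IsSubcubeMap.comp {α η ι θ : Type*} {g : (η → α) → (ι → α)} {h : (θ → α) → (η → α)}
    (hg : IsSubcubeMap g) (hh : IsSubcubeMap h) : IsSubcubeMap (g ∘ h) := by
  refine ⟨fun i x y => ?_, fun j => ?_⟩
  · rcases hg.1 i (h x) (h y) with e | ⟨j, e1, e2⟩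
    · exact Or.inl e
    · rcases hh.1 j x y with e' | ⟨k, e1', e2'⟩
      · left; simp [e1, e2, e']
      · right; exact ⟨k, e1.trans e1', e2.trans e2'⟩
  · obtain ⟨i, hi⟩ := hh.2 j
    obtain ⟨k, hk⟩ := hg.2 i
    exact ⟨k, fun x => (hk _).trans (hi x)⟩

theorem Combinatorics.Subspace.isSubcubeMap {α η ι : Type*} (l : Subspace η α ι) :
    IsSubcubeMap (fun x => l x) := by
  refine ⟨fun i x y => ?_, fun j => ?_⟩
  · rcases h : l.idxFun i with a | j
    · left; simp [Subspace.coe_apply, h]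
    · right; exact ⟨j, by simp [Subspace.coe_apply, h]⟩
  · obtain ⟨i, hi⟩ := l.proper j
    exact ⟨i, fun x => by simp [Subspace.coe_apply, hi]⟩

/-- A map into a cube is isometric if its coordinate distances are dominated by the distance in the
source and dominate the coordinate distances of another isometric map. -/
theorem isometry_pi_of_coordinates {X α β ι η : Type*} [Fintype ι] [Fintype η]
    [PseudoMetricSpace X] [PseudoMetricSpace α] [PseudoMetricSpace β]
    {f : X → (ι → β)} {e : X → (η → α)} (he : Isometry e)
    (h1 : ∀ i x y, dist (f x i) (f y i) ≤ dist x y)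
    (h2 : ∀ j, ∃ i, ∀ x y, dist (e x j) (e y j) ≤ dist (f x i) (f y i)) : Isometry f := by
  refine Isometry.of_dist_eq fun x y => le_antisymm ?_ ?_
  · exact (dist_pi_le_iff dist_nonneg).2 fun i => h1 i x y
  · rw [← he.dist_eq]
    refine (dist_pi_le_iff dist_nonneg).2 fun j => ?_
    obtain ⟨i, hi⟩ := h2 j
    exact (hi x y).trans (dist_le_pi_dist _ _ i)

theorem IsSubcubeMap.isometry {α η ι : Type*} [Fintype ι] [Fintype η] [PseudoMetricSpace α]
    {g : (η → α) → (ι → α)} (hg : IsSubcubeMap g) : Isometry g := by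
  refine isometry_pi_of_coordinates isometry_id (fun i x y => ?_) fun j => ?_
  · rcases hg.1 i x y with e | ⟨j, e1, e2⟩
    · simp [e, dist_nonneg]
    · rw [e1, e2]; exact dist_le_pi_dist x y j
  · obtain ⟨i, hi⟩ := hg.2 j
    exact ⟨i, fun x y => by simp [hi]⟩

theorem HasRainbowCopy.of_comp {X α η ι κ : Type*} [Fintype ι] [Fintype η] [PseudoMetricSpace X]
    [PseudoMetricSpace α] {g : (η → α) → (ι → α)} (hg : IsSubcubeMap g) {c : (ι → α) → κ}
    (h : HasRainbowCopy X (c ∘ g)) : HasRainbowCopy X c := by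
  obtain ⟨f, hf, hc⟩ := h
  exact ⟨g ∘ f, hg.isometry.comp hf, hc⟩

/-- Hall's theorem for a family of large sets of colours. -/
theorem exists_injective_comp_of_card_le {X J κ : Type*} [Finite X] [Finite J] (c : X → J → κ)
    (h : ∀ x, Nat.card X ≤ (Set.range (c x)).ncard) :
    ∃ j : X → J, Injective fun x => c x (j x) := by
  classical
  have := Fintype.ofFinite X
  have := Fintype.ofFinite J
  obtain ⟨f, hf, hf'⟩ := (Finset.all_card_le_biUnion_card_iff_exists_injective
    (fun x => Finset.univ.image (c x))).1 (by
      intro s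
      rcases s.eq_empty_or_nonempty with rfl | ⟨x, hx⟩
      · simp
      -- One member of the union already has `|X|` colours, which is Hall's condition.
      · calc s.card ≤ Fintype.card X := s.card_le_univ
          _ ≤ (Finset.univ.image (c x)).card := by
            have := h x
            rwa [Nat.card_eq_fintype_card, ← Set.image_univ, ← Finset.coe_univ,
              ← Finset.coe_image, Set.ncard_coe_finset] at this
          _ ≤ _ := Finset.card_le_card
            (Finset.subset_biUnion_of_mem (fun x => Finset.univ.image (c x)) hx))
  have hj : ∀ x, ∃ j, c x j = f x := fun x => by simpa using hf' x
  choose j hj using hj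
  exact ⟨j, by simpa only [hj] using hf⟩

/-- Among sufficiently many columns of colours, each row using few colours, two columns agree. -/
theorem exists_lt_forall_eq_of_ncard_lt {P κ : Type*} [Finite P] (k : ℕ) {L : ℕ}
    (hL : Nat.card (P → Fin (k + 1)) ≤ L) (c : P → Fin (L + 1) → κ)
    (h : ∀ p, (Set.range (c p)).ncard < k) :
    ∃ j j' : Fin (L + 1), j < j' ∧ ∀ p, c p j = c p j' := by
  classical
  -- `κ` may be infinite; encoding each row in a fixed finite type bounds the number of possible
  -- columns.
  have hφ : ∀ p, ∃ φ : Set.range (c p) → Fin (k + 1), Injective φ := fun p => by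
    have := Fintype.ofFinite (Set.range (c p))
    have e : Fintype.card (Set.range (c p)) ≤ Fintype.card (Fin (k + 1)) := by
      rw [← Nat.card_eq_fintype_card, Nat.card_coe_set_eq, Fintype.card_fin]
      exact (h p).le.trans (Nat.le_succ k)
    obtain ⟨φ⟩ := Function.Embedding.nonempty_of_card_le e
    exact ⟨φ, φ.injective⟩
  choose φ hφ using hφ
  have := Fintype.ofFinite P
  obtain ⟨j, j', hne, heq⟩ := Fintype.exists_ne_map_eq_of_card_lt
    (fun (j : Fin (L + 1)) (p : P) => φ p ⟨c p j, j, rfl⟩) (by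
      rw [← Nat.card_eq_fintype_card, Fintype.card_fin]; omega)
  have key : ∀ p, c p j = c p j' := fun p =>
    congrArg Subtype.val (hφ p (congrFun heq p))
  rcases lt_or_gt_of_ne hne with hlt | hlt
  · exact ⟨j, j', hlt, key⟩
  · exact ⟨j', j, hlt, fun p => (key p).symm⟩

/-! ### Insensitive coordinates -/

/-- Either there is a rainbow copy of `X`, or one coordinate of a subcube becomes insensitive to
switching `a` to `b`; the coordinates in `ε` are left alone. -/
theorem exists_subcube_insensitive_coordinate (X α ε η : Type) [Finite X] [MetricSpace X] [Finite α]
    [MetricSpace α] [Fintype ε] [Fintype η] {e : X → (η → α)} (he : Isometry e) {a b : α}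
    (hab : ∀ x y : X, x ≠ y → dist a b ≤ dist x y) :
    ∃ (ι : Type) (_ : Fintype ι), (∃ e : X → (ι → α), Isometry e) ∧
      ∀ {κ : Type*} (c : (ε ⊕ ι → α) → κ), HasRainbowCopy X c ∨
      ∃ g : (ε ⊕ Option η → α) → (ε ⊕ ι → α), IsSubcubeMap g ∧
        (∀ x y, (∀ j, x (Sum.inr j) = y (Sum.inr j)) → ∀ i, g x (Sum.inr i) = g y (Sum.inr i)) ∧
        (∀ x i, g x (Sum.inl i) = x (Sum.inl i)) ∧
        ∀ x y, (∀ i, x (Sum.inl i) = y (Sum.inl i)) →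
          (∀ j, x (Sum.inr (some j)) = y (Sum.inr (some j))) →
          x (Sum.inr none) = a → y (Sum.inr none) = b → c (g x) = c (g y) := by
  classical
  obtain ⟨ι, _, hι⟩ := Subspace.exists_mono_in_high_dimension α ((ε → α) → Prop) η
  set L := Nat.card ((ε → α) × (η → α) → Fin (Nat.card X + 1)) with hL
  refine ⟨Fin L ⊕ ι, inferInstance, ?_, fun {κ} c => ?_⟩
  -- The trivial colouring is used only to get some subspace; the embedding is needed to iterate.
  · obtain ⟨l, -⟩ := hι fun _ _ => True
    have hl := l.isSubcubeMap.isometry.comp he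
    refine ⟨fun x => Sum.elim (fun _ => a) (l (e x)),
      isometry_pi_of_coordinates hl (fun i x y => ?_) fun i => ⟨Sum.inr i, fun x y => le_rfl⟩⟩
    rcases i with i | i
    · simp
    · rw [← hl.dist_eq]
      exact dist_le_pi_dist (l (e x)) (l (e y)) i
  -- Staircase words `a^j b^(L-j)`: two of them differ exactly on an interval, which changes from
  -- `b` to `a`.
  let W : Fin (L + 1) → Fin L → α := fun j i => if (i : ℕ) < j then a else b
  let w : (ε → α) → Fin (L + 1) → (ι → α) → (ε ⊕ (Fin L ⊕ ι) → α) := fun u j p =>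
    Sum.elim u (Sum.elim (W j) p)
  -- A word `p` is coloured by the set of those `u` for which the staircase gives many colours.
  obtain ⟨l, C, hC⟩ := hι fun p u => Nat.card X ≤ (Set.range fun j => c (w u j p)).ncard
  have hl := l.isSubcubeMap
  by_cases h : ∃ u, C u
  · left
    obtain ⟨u, hu⟩ := h
    obtain ⟨j, hj⟩ := exists_injective_comp_of_card_le (fun x j => c (w u j (l (e x))))
      (fun x => by have := congrFun (hC (e x)) u; simp only at this; rw [this]; exact hu)
    refine ⟨fun x => w u (j x) (l (e x)), ?_, hj⟩
    refine isometry_pi_of_coordinates (hl.isometry.comp he) (fun i x y => ?_)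
      fun i => ⟨Sum.inr (Sum.inr i), fun x y => le_rfl⟩
    rcases eq_or_ne x y with rfl | hxy
    · simp
    rcases i with i | i | i
    · simp [w]
    · have := hab x y hxy
      simp only [w, W, Sum.elim_inr, Sum.elim_inl]
      split_ifs <;> simp [this, dist_comm b a]
    · rw [← (hl.isometry.comp he).dist_eq]
      exact dist_le_pi_dist (l (e x)) (l (e y)) i
  · right
    push Not at h
    obtain ⟨j, j', hlt, hjj⟩ := exists_lt_forall_eq_of_ncard_lt (Nat.card X) hL.ge
      (fun (p : (ε → α) × (η → α)) j => c (w p.1 j (l p.2))) (fun p => by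
        have := congrFun (hC p.2) p.1
        simp only at this
        have h' := h p.1
        rw [← this] at h'
        exact not_le.1 h')
    -- The interval `[j, j')` becomes the new coordinate: `a` there gives `W j'`, `b` gives `W j`.
    let g : (ε ⊕ Option η → α) → (ε ⊕ (Fin L ⊕ ι) → α) := fun x =>
      Sum.elim (fun i => x (Sum.inl i)) (Sum.elim
        (fun i => if (i : ℕ) < j then a else if (i : ℕ) < j' then x (Sum.inr none) else b)
        (l fun i => x (Sum.inr (some i))))
    refine ⟨g, ⟨fun i x y => ?_, ?_⟩, fun x y hxy i => ?_, fun x i => rfl, ?_⟩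
    · rcases i with i | i | i
      · exact Or.inr ⟨_, rfl, rfl⟩
      · simp only [g, Sum.elim_inr, Sum.elim_inl]
        split_ifs
        · exact Or.inl rfl
        · exact Or.inr ⟨_, rfl, rfl⟩
        · exact Or.inl rfl
      · rcases hl.1 i (fun i => x (Sum.inr (some i))) (fun i => y (Sum.inr (some i)))
          with h | ⟨j, h1, h2⟩
        · exact Or.inl h
        · exact Or.inr ⟨_, h1, h2⟩
    · rintro (i | _ | i)
      · exact ⟨Sum.inl i, fun x => rfl⟩
      · have hj : (j : ℕ) < j' := hlt
        refine ⟨Sum.inr (Sum.inl ⟨j, by omega⟩), fun x => ?_⟩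
        simp [g, hj]
      · obtain ⟨k, hk⟩ := hl.2 i
        exact ⟨Sum.inr (Sum.inr k), fun x => hk _⟩
    · rcases i with i | i
      · simp only [g, Sum.elim_inr, Sum.elim_inl, hxy]
      · simp only [g, Sum.elim_inr, hxy]
    · intro x y h1 h2 hx hy
      have hj : (j : ℕ) < j' := hlt
      have gx : g x = w (fun i => x (Sum.inl i)) j' (l fun i => x (Sum.inr (some i))) := by
        funext i
        rcases i with i | i | i
        · rfl
        · simp only [g, w, W, Sum.elim_inr, Sum.elim_inl, hx]
          split_ifs <;> first | rfl | omega
        · rfl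
      have gy : g y = w (fun i => x (Sum.inl i)) j (l fun i => x (Sum.inr (some i))) := by
        funext i
        rcases i with i | i | i
        · simp [g, w, h1]
        · simp only [g, w, W, Sum.elim_inr, Sum.elim_inl, hy]
          split_ifs <;> rfl
        · simp only [g, w, Sum.elim_inr, h2]
      rw [gx, gy]
      exact (hjj (_, _)).symm

/-- Either there is a rainbow copy of `X`, or the first `n` coordinates of a subcube become
insensitive to switching `a` to `b`. -/
theorem exists_subcube_insensitive_sum (X α : Type) [Finite X] [MetricSpace X] [Finite α]
    [MetricSpace α] {a b : α} (hab : ∀ x y : X, x ≠ y → dist a b ≤ dist x y) (n : ℕ) :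
    ∀ (η : Type) [Fintype η] {e : X → (η → α)}, Isometry e →
      ∃ (ι : Type) (_ : Fintype ι), ∀ {κ : Type*} (c : (ι → α) → κ), HasRainbowCopy X c ∨
        ∃ g : (Fin n ⊕ η → α) → (ι → α), IsSubcubeMap g ∧
          ∀ x y, (∀ i, x (Sum.inl i) = y (Sum.inl i) ∨ x (Sum.inl i) = a ∧ y (Sum.inl i) = b) →
            (∀ j, x (Sum.inr j) = y (Sum.inr j)) → c (g x) = c (g y) := by
  induction n with
  | zero =>
    refine fun η _ e he => ⟨Fin 0 ⊕ η, inferInstance, fun c => Or.inr ⟨id,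
      ⟨fun i x y => Or.inr ⟨i, rfl, rfl⟩, fun j => ⟨j, fun x => rfl⟩⟩, fun x y _ h => ?_⟩⟩
    congr 2
    funext i
    rcases i with i | i
    · exact i.elim0
    · exact h i
  | succ n ih =>
    intro η _ e he
    -- The dimension `ι₁` is fixed first, but `g₁` is found first; `g₂` then works inside its
    -- remaining coordinates.
    obtain ⟨ι₁, _, ⟨e₁, he₁⟩, h₁⟩ := exists_subcube_insensitive_coordinate X α (Fin n) η he hab
    obtain ⟨ι, _, hι⟩ := ih ι₁ he₁
    refine ⟨ι, inferInstance, fun c => ?_⟩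
    rcases hι c with h | ⟨g₁, hg₁, hc₁⟩
    · exact Or.inl h
    rcases h₁ (c ∘ g₁) with h | ⟨g₂, hg₂, hr, hl, hc₂⟩
    · exact Or.inl (h.of_comp hg₁)
    let s : (Fin (n + 1) ⊕ η → α) → (Fin n ⊕ Option η → α) := fun x =>
      Sum.elim (fun i => x (Sum.inl i.succ))
        (fun o => o.elim (x (Sum.inl 0)) fun j => x (Sum.inr j))
    have hs : IsSubcubeMap s := by
      refine ⟨?_, ?_⟩
      · rintro (i | _ | i) x y <;> exact Or.inr ⟨_, rfl, rfl⟩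
      · rintro (i | i)
        · refine Fin.cases ⟨Sum.inr none, fun x => rfl⟩ (fun i => ⟨Sum.inl i, fun x => rfl⟩) i
        · exact ⟨Sum.inr (some i), fun x => rfl⟩
    refine Or.inr ⟨g₁ ∘ g₂ ∘ s, hg₁.comp (hg₂.comp hs), fun x y h1 h2 => ?_⟩
    -- Intermediate point: from `x` to `z` only the new coordinate switches, from `z` to `y` only
    -- the `n` old ones, which `g₂` keeps.
    let z : Fin n ⊕ Option η → α := Sum.elim (fun i => x (Sum.inl i.succ)) (s y ∘ Sum.inr)
    have hxz : c (g₁ (g₂ (s x))) = c (g₁ (g₂ z)) := by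
      rcases h1 0 with h0 | ⟨ha, hb⟩
      · have : s x = z := by
          funext i
          rcases i with i | _ | i
          · rfl
          · exact h0
          · exact h2 i
        rw [this]
      · exact hc₂ (s x) z (fun i => rfl) (fun j => h2 j) ha hb
    refine hxz.trans (hc₁ (g₂ z) (g₂ (s y)) (fun i => ?_) fun j => hr z (s y) (fun j => rfl) j)
    rw [hl z, hl (s y)]
    exact h1 i.succ

/-- Either there is a rainbow copy of `X`, or an `n`-dimensional subcube is insensitive to all
switches from a list. -/
theorem exists_subcube_insensitive_list (X α : Type) [Finite X] [MetricSpace X] [Finite α]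
    [MetricSpace α] {η : Type} [Fintype η] {e : X → (η → α)} (he : Isometry e)
    (l : List (α × α)) (hl : ∀ p ∈ l, ∀ x y : X, x ≠ y → dist p.1 p.2 ≤ dist x y) :
    ∀ n : ℕ, ∃ m : ℕ, ∀ {κ : Type*} (c : (Fin m → α) → κ), HasRainbowCopy X c ∨
      ∃ g : (Fin n → α) → (Fin m → α), IsSubcubeMap g ∧
        ∀ p ∈ l, ∀ x y, (∀ i, x i = y i ∨ x i = p.1 ∧ y i = p.2) → c (g x) = c (g y) := by
  induction l with
  | nil =>
    exact fun n => ⟨n, fun c => Or.inr ⟨id,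
      ⟨fun i x y => Or.inr ⟨i, rfl, rfl⟩, fun j => ⟨j, fun x => rfl⟩⟩, by simp⟩⟩
  | cons p l ih =>
    intro n
    obtain ⟨ι, _, hι⟩ := exists_subcube_insensitive_sum X α (hl p (by simp)) n η he
    let E := Fintype.equivFin ι
    obtain ⟨m, hm⟩ := ih (fun q hq => hl q (by simp [hq])) (Fintype.card ι)
    refine ⟨m, fun c => ?_⟩
    rcases hm c with h | ⟨g₁, hg₁, hc₁⟩
    · exact Or.inl h
    let r : (ι → α) → (Fin (Fintype.card ι) → α) := fun x => x ∘ E.symm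
    have hr : IsSubcubeMap r :=
      ⟨fun i x y => Or.inr ⟨E.symm i, rfl, rfl⟩, fun j => ⟨E j, fun x => by simp [r]⟩⟩
    rcases hι (c ∘ g₁ ∘ r) with h | ⟨g₂, hg₂, hc₂⟩
    · exact Or.inl (h.of_comp (hg₁.comp hr))
    let s : (Fin n → α) → (Fin n ⊕ η → α) := fun x => Sum.elim x fun _ => p.1
    have hs : ∀ i x y, s x i = s y i ∨ ∃ j, s x i = x j ∧ s y i = y j := by
      rintro (i | i) x y
      · exact Or.inr ⟨i, rfl, rfl⟩
      · exact Or.inl rfl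
    have hg : IsSubcubeMap (g₁ ∘ r ∘ g₂ ∘ s) :=
      hg₁.comp (hr.comp (hg₂.comp ⟨hs, fun j => ⟨Sum.inl j, fun x => rfl⟩⟩))
    have hrgs : IsSubcubeMap (r ∘ g₂ ∘ s) :=
      hr.comp (hg₂.comp ⟨hs, fun j => ⟨Sum.inl j, fun x => rfl⟩⟩)
    refine Or.inr ⟨_, hg, fun q hq x y hxy => ?_⟩
    rcases List.mem_cons.1 hq with rfl | hq
    · exact hc₂ (s x) (s y) hxy fun j => rfl
    -- Subcube maps send switches to switches, so earlier insensitivity survives.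
    · refine hc₁ q hq _ _ fun i => ?_
      rcases hrgs.1 i x y with h | ⟨j, h1, h2⟩
      · exact Or.inl h
      · exact h1.symm ▸ h2.symm ▸ hxy j

/-- A finite metric space `X` in the cube `Fin d → α`, where any two points of `α` are joined by a
chain of short steps, has a monochromatic or rainbow copy in every colouring of a large cube. -/
theorem exists_constant_or_injective_copy (X α : Type) [Finite X] [MetricSpace X] [Finite α]
    [MetricSpace α] {d : ℕ} {e : X → (Fin d → α)} (he : Isometry e) {δ : ℝ}
    (hδ : ∀ x y : X, x ≠ y → δ ≤ dist x y)
    (hα : ∀ a b : α, Relation.ReflTransGen (fun a b => dist a b ≤ δ) a b) :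
    ∃ m : ℕ, ∀ {κ : Type*} (c : (Fin m → α) → κ), ∃ f : X → (Fin m → α), Isometry f ∧
      ((∀ x y, c (f x) = c (f y)) ∨ Injective (c ∘ f)) := by
  classical
  have := Fintype.ofFinite α
  obtain ⟨m, hm⟩ := exists_subcube_insensitive_list X α he
    (Finset.univ.filter fun p : α × α => dist p.1 p.2 ≤ δ).toList
    (fun p hp x y hxy => by
      have : dist p.1 p.2 ≤ δ := by simpa using hp
      exact this.trans (hδ x y hxy)) d
  refine ⟨m, fun c => ?_⟩
  rcases hm c with ⟨f, hf, hc⟩ | ⟨g, hg, hc⟩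
  · exact ⟨f, hf, Or.inr hc⟩
  refine ⟨g ∘ e, hg.isometry.comp he, Or.inl ?_⟩
  have hupd : ∀ (x : Fin d → α) i a b, c (g (update x i a)) = c (g (update x i b)) := by
    intro x i a b
    induction hα a b with
    | refl => rfl
    | @tail b b' _ hb ih =>
      refine ih.trans (hc (b, b') (by simpa using hb) _ _ fun j => ?_)
      rcases eq_or_ne j i with rfl | hj
      · right; simp
      · left; simp [hj]
  have hconst : ∀ (x y : Fin d → α) (s : Finset (Fin d)),
      c (g (s.piecewise y x)) = c (g x) := by
    intro x y s
    induction s using Finset.induction_on with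
    | empty => simp
    | insert i s hi ih =>
      rw [Finset.piecewise_insert, hupd _ i (y i) (s.piecewise y x i), update_eq_self, ih]
  intro x y
  simpa using (hconst (e x) (e y) Finset.univ).symm

/-! ### Passage from `ℝ` to a finite alphabet -/

/-- A finite set of reals extends to one in which any two points are joined by a chain of short
steps. -/
theorem exists_finset_chain_connected (S : Finset ℝ) {δ : ℝ} (hδ : 0 < δ) :
    ∃ A : Finset ℝ, S ⊆ A ∧
      ∀ a b : A, Relation.ReflTransGen (fun a b : A => dist a b ≤ δ) a b := by
  classical
  obtain ⟨K, hK⟩ : ∃ K : ℕ, ∀ s ∈ S, ⌊s / δ⌋.natAbs ≤ K :=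
    ⟨S.sup fun s => ⌊s / δ⌋.natAbs, fun s hs => Finset.le_sup (f := fun s => ⌊s / δ⌋.natAbs) hs⟩
  -- Each `s ∈ S` is within `δ` of the grid point `⌊s / δ⌋ * δ`.
  let G := (Finset.Icc (-K : ℤ) K).image fun i : ℤ => i * δ
  refine ⟨S ∪ G, Finset.subset_union_left, ?_⟩
  let R : ↥(S ∪ G) → ↥(S ∪ G) → Prop := fun a b => dist a b ≤ δ
  have : Std.Symm R := ⟨fun a b (h : dist a b ≤ δ) => (dist_comm b a).trans_le h⟩
  have hR : Std.Symm (Relation.ReflTransGen R) := inferInstance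
  have hG : ∀ i : ℤ, i ∈ Finset.Icc (-K : ℤ) K → (i : ℝ) * δ ∈ S ∪ G := fun i hi =>
    Finset.mem_union_right _ (Finset.mem_image_of_mem _ hi)
  have hgrid : ∀ (n : ℕ) (hn : -(K : ℤ) + n ∈ Finset.Icc (-K : ℤ) K),
      Relation.ReflTransGen R ⟨_, hG (-K) (by simp)⟩ ⟨_, hG _ hn⟩ := by
    intro n
    induction n with
    | zero =>
      intro hn
      convert Relation.ReflTransGen.refl using 2
      simp
    | succ n ih =>
      intro hn
      have hn' : -(K : ℤ) + n ∈ Finset.Icc (-K : ℤ) K := by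
        simp only [Finset.mem_Icc] at hn ⊢; push_cast at hn; omega
      refine (ih hn').tail ?_
      change |((-(K : ℤ) + n : ℤ) : ℝ) * δ - ((-(K : ℤ) + (n + 1 : ℕ) : ℤ) : ℝ) * δ| ≤ δ
      rw [← sub_mul, abs_mul, abs_of_pos hδ]
      push_cast
      ring_nf
      simp
  have hgrid' : ∀ (i : ℤ) (hi : i ∈ Finset.Icc (-K : ℤ) K),
      Relation.ReflTransGen R ⟨_, hG (-K) (by simp)⟩ ⟨_, hG i hi⟩ := by
    intro i hi
    obtain ⟨n, rfl⟩ : ∃ n : ℕ, i = -(K : ℤ) + n :=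
      ⟨(i + K).toNat, by simp only [Finset.mem_Icc] at hi; omega⟩
    exact hgrid n hi
  have hall : ∀ a : ↥(S ∪ G), Relation.ReflTransGen R ⟨_, hG (-K) (by simp)⟩ a := by
    rintro ⟨a, ha⟩
    rcases Finset.mem_union.1 ha with hS | hg
    · have hi : ⌊a / δ⌋ ∈ Finset.Icc (-K : ℤ) K := by
        have := hK a hS
        simp only [Finset.mem_Icc]; omega
      refine (hgrid' _ hi).tail ?_
      change |(⌊a / δ⌋ : ℝ) * δ - a| ≤ δ
      have h1 : (⌊a / δ⌋ : ℝ) * δ ≤ a := (le_div_iff₀ hδ).1 (Int.floor_le _)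
      have h2 : a < ((⌊a / δ⌋ : ℝ) + 1) * δ := (div_lt_iff₀ hδ).1 (Int.lt_floor_add_one _)
      rw [abs_le]
      constructor <;> linarith
    · obtain ⟨i, hi, rfl⟩ := Finset.mem_image.1 hg
      exact hgrid' i hi
  exact fun a b => (hR.symm _ _ (hall a)).trans (hall b)

/-- Working with all small `δ` also covers spaces with at most one point, where there is no minimal
distance. -/
theorem exists_pos_le_dist (X : Type*) [Finite X] [MetricSpace X] :
    ∃ δ > 0, ∀ x y : X, x ≠ y → δ ≤ dist x y := by
  have h : ∀ᶠ δ in nhdsWithin (0 : ℝ) (Set.Ioi 0), ∀ p : X × X, p.1 ≠ p.2 → δ ≤ dist p.1 p.2 := by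
    refine Filter.eventually_all.2 fun p => ?_
    by_cases hp : p.1 = p.2
    · simp [hp]
    · filter_upwards [Ioo_mem_nhdsGT (dist_pos.2 hp)] with δ hδ _ using hδ.2.le
  obtain ⟨δ, h, h0⟩ := (h.and self_mem_nhdsWithin).exists
  exact ⟨δ, h0, fun x y => h (x, y)⟩

theorem theorem5 (d : ℕ) (M : Set (Fin d → ℝ)) (hM : M.Finite) :
    ∃ n : ℕ, ∀ (κ : Type*) (c : (Fin n → ℝ) → κ),
      ∃ M' : Set (Fin n → ℝ), IsMaxNormCopy M M' ∧ (IsMonochromatic c M' ∨ IsRainbow c M') := by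
  classical
  have := hM.to_subtype
  obtain ⟨δ, hδ0, hδ⟩ := exists_pos_le_dist M
  obtain ⟨A, hA, hchain⟩ := exists_finset_chain_connected
    ((Set.finite_range fun p : M × Fin d => p.1.1 p.2).toFinset) hδ0
  let e : M → (Fin d → A) := fun x i => ⟨x.1 i, hA (by
    rw [Set.Finite.mem_toFinset]; exact ⟨(x, i), rfl⟩)⟩
  have he : Isometry e := isometry_pi_of_coordinates (isometry_subtype_coe (s := M))
    (fun i x y => dist_le_pi_dist x.1 y.1 i) fun i => ⟨i, fun x y => le_rfl⟩
  obtain ⟨n, hn⟩ := exists_constant_or_injective_copy M A he hδ hchain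
  refine ⟨n, fun κ c => ?_⟩
  obtain ⟨f, hf, hc⟩ := hn fun w : Fin n → A => c fun i => w i
  let F : M → (Fin n → ℝ) := fun x i => f x i
  have hF : Isometry F := isometry_pi_of_coordinates hf
    (fun i x y => (dist_le_pi_dist (f x) (f y) i).trans_eq (hf.dist_eq x y))
    fun i => ⟨i, fun x y => le_rfl⟩
  -- The value `0` outside `M` plays no role.
  let F' : (Fin d → ℝ) → (Fin n → ℝ) := fun x => if h : x ∈ M then F ⟨x, h⟩ else 0
  have hF' : ∀ x (h : x ∈ M), F' x = F ⟨x, h⟩ := fun x h => dif_pos h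
  have hnorm : ∀ x ∈ M, ∀ y ∈ M, ‖F' x - F' y‖ = ‖x - y‖ := fun x hx y hy => by
    rw [hF' x hx, hF' y hy, ← dist_eq_norm, ← dist_eq_norm, hF.dist_eq, Subtype.dist_eq]
  refine ⟨F' '' M, ⟨F', ⟨Set.mapsTo_image _ _, fun x hx y hy hxy => ?_, Set.surjOn_image _ _⟩,
    hnorm⟩, ?_⟩
  · have := hnorm x hx y hy
    rwa [hxy, sub_self, norm_zero, eq_comm, norm_sub_eq_zero_iff] at this
  · rcases hc with hc | hc
    · left
      rintro _ ⟨x, hx, rfl⟩ _ ⟨y, hy, rfl⟩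
      rw [hF' x hx, hF' y hy]
      exact hc _ _
    · right
      rintro _ ⟨x, hx, rfl⟩ _ ⟨y, hy, rfl⟩ hne h
      rw [hF' x hx, hF' y hy] at h
      have : (⟨x, hx⟩ : M) = ⟨y, hy⟩ := hc h
      exact hne (by rw [Subtype.mk.inj this])
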